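/- Let $d\ge 1$ and let $\beta,b:\mathbb R\to\mathbb R$, $D:\mathbb R^d\to\mathbb R^d$, $\Phi:\mathbb R^d\to\mathbb R$ satisfy the following hypotheses. (i) $\beta\in C^1(\mathbb R)$, $\beta(0)=0$, and there are constants $\gamma_1,\gamma_2$ with $0<\gamma_1\le\beta'(r)\le\gamma_2<\infty$ for all $r\in\mathbb R$. (ii) $b\in C^1(\mathbb R)$ is bounded, and there are constants $b_0>0$ and $\gamma_3<\infty$ with $b(r)\ge b_0$ and $|b'(r)r+b(r)|\le\gamma_3$ for all $r\in\mathbb R$. (iii) $D\in L^\infty(\mathbb R^d;\mathbb R^d)\cap W^{1,1}_{\rm loc}(\mathbb R^d;\mathbb R^d)$ and $\operatorname{div}D\in L^2(\mathbb R^d)+L^\infty(\mathbb R^d)$. (iv) $D=-\nabla\Phi$, where $\Phi\in C(\mathbb R^d)\cap W^{2,1}_{\rm loc}(\mathbb R^d)$, $\Phi\ge1$, $\lim_{|x|\to\infty}\Phi(x)=+\infty$, and $\Phi^{-m}\in L^1(\mathbb R^d)$ for some $m\ge2$. Put $b^*(r)=b(r)r$. Let $H^1=H^1(\mathbb R^d)$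 and let $H^{-1}$ be its dual, with the inclusion $H^1\subset L^2\subset H^{-1}$ given by $y\mapsto\bigl(\varphi\mapsto\int_{\mathbb R^d}y\varphi\,dx\bigr)$, and endow $H^{-1}$ with the inner product $\langle y_1,y_2\rangle_{-1}=((I-\Delta)^{-1}y_1,y_2)$, where $I-\Delta:H^1\to H^{-1}$ is the isomorphism $((I-\Delta)u)(\varphi)=\int(u\varphi+\nabla u\cdot\nabla\varphi)\,dx$ and $(\cdot,\cdot)$ is the duality pairing of $H^1$ and $H^{-1}$. Let $A^*y=-\Delta\beta(y)+\operatorname{div}(D\,b^*(y))$ be the operator in $H^{-1}$ with domain $D(A^*)=H^1$, that is, for $y\in H^1$, $A^*y\in H^{-1}$ is given by $$(A^*y)(\varphi)=\int_{\mathbb R^d}\bigl(\nabla\beta(y)-D\,b^*(y)\bigr)\cdot\nabla\varphi\,dx\qquad\text{for all }\varphi\in H^1.$$ Then $A^*$ is quasi-$m$-accretive in $H^{-1}$: there is $\omega\ge0$ such that $B=A^*+\omega I$ (with domain $H^1$) is $m$-accretive, i.e. $\langle By_1-By_2,\,y_1-y_2\rangle_{-1}\ge0$ for all $y_1,y_2\in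 H^1$, and the range of $I+\lambda B$ is all of $H^{-1}$ for every $\lambda>0$. -/

import Mathlib

namespace NFPE

open MeasureTheory Filter Topology
open scoped ContDiff ENNReal NNReal RealInnerProductSpace

noncomputable section

/-- The space `ℝ^d` with the Euclidean norm. -/
abbrev Space (d : ℕ) := EuclideanSpace ℝ (Fin d)

/-- The real Hilbert space `L²(ℝ^d)`. -/
abbrev L2 (d : ℕ) := Lp ℝ 2 (volume : Measure (Space d))

/-- The real Hilbert space `L²(ℝ^d; ℝ^d)`. -/
abbrev L2Vec (d : ℕ) := Lp (Space d) 2 (volume : Measure (Space d))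

/-- The classical partial derivative `∂φ/∂x_i`. -/
def partialDeriv {d : ℕ} (i : Fin d) (φ : Space d → ℝ) (x : Space d) : ℝ :=
  fderiv ℝ φ x (EuclideanSpace.single i 1)

/-- Test functions: the class `C_0^∞(ℝ^d)`. -/
structure IsTestFunction {d : ℕ} (φ : Space d → ℝ) : Prop where
  smooth : ContDiff ℝ ∞ φ
  compact : HasCompactSupport φ

/-- `g ∈ L¹_loc` is the weak `i`-th partial derivative of `u ∈ L¹_loc`. -/
structure IsWeakPartial {d : ℕ} (i : Fin d) (u g : Space d → ℝ) : Prop where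
  locallyIntegrable : LocallyIntegrable u
  locallyIntegrable_deriv : LocallyIntegrable g
  integral_eq : ∀ φ : Space d → ℝ, IsTestFunction φ →
    ∫ x, u x * partialDeriv i φ x = -∫ x, g x * φ x

/-- `G ∈ L¹_loc(ℝ^d; ℝ^d)` is the weak gradient of `u ∈ L¹_loc(ℝ^d)`. -/
def IsWeakGradient {d : ℕ} (u : Space d → ℝ) (G : Space d → Space d) : Prop :=
  ∀ i : Fin d, IsWeakPartial i u (fun x => G x i)

/-! ### Auxiliary facts on weak derivatives -/

section Aux

variable {d : ℕ}

lemma IsTestFunction.continuous {φ : Space d → ℝ} (h : IsTestFunction φ) : Continuous φ :=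
  h.smooth.continuous

lemma IsTestFunction.memLp {φ : Space d → ℝ} (h : IsTestFunction φ) :
    MemLp φ 2 (volume : Measure (Space d)) :=
  h.continuous.memLp_of_hasCompactSupport h.compact

lemma IsTestFunction.partialDeriv {φ : Space d → ℝ} (h : IsTestFunction φ) (i : Fin d) :
    IsTestFunction (NFPE.partialDeriv i φ) := by
  constructor
  · exact (h.smooth.fderiv_right (m := ∞) (by simp)).clm_apply contDiff_const
  · exact h.compact.fderiv_apply ℝ _

lemma IsTestFunction.add {φ ψ : Space d → ℝ} (h : IsTestFunction φ) (h' : IsTestFunction ψ) :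
    IsTestFunction (φ + ψ) :=
  ⟨h.smooth.add h'.smooth, h.compact.add h'.compact⟩

lemma IsTestFunction.smul {φ : Space d → ℝ} (c : ℝ) (h : IsTestFunction φ) :
    IsTestFunction (c • φ) :=
  ⟨contDiff_const.smul h.smooth, h.compact.smul_left⟩

lemma IsTestFunction.zero : IsTestFunction (0 : Space d → ℝ) :=
  ⟨contDiff_const, HasCompactSupport.zero⟩

lemma IsTestFunction.translate {φ : Space d → ℝ} (h : IsTestFunction φ) (v : Space d) :
    IsTestFunction (fun x => φ (x + v)) :=
  ⟨h.smooth.comp (contDiff_id.add contDiff_const),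
    h.compact.comp_homeomorph (Homeomorph.addRight v)⟩

lemma L2.locallyIntegrable {F : Type*} [NormedAddCommGroup F]
    (u : Lp F 2 (volume : Measure (Space d))) : LocallyIntegrable u :=
  (Lp.memLp u).locallyIntegrable (by norm_num)

/-- The class in `L²` of a test function. -/
def IsTestFunction.toL2 {φ : Space d → ℝ} (h : IsTestFunction φ) : L2 d := h.memLp.toLp φ

lemma IsTestFunction.inner_toL2 {φ : Space d → ℝ} (h : IsTestFunction φ) (u : L2 d) :
    ⟪h.toL2, u⟫ = ∫ x, u x * φ x := by
  rw [MeasureTheory.L2.inner_def]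
  apply integral_congr_ae
  filter_upwards [h.memLp.coeFn_toLp] with x hx
  simp only [IsTestFunction.toL2, hx]
  simp [mul_comm]

lemma isWeakPartial_iff (i : Fin d) (u g : L2 d) :
    IsWeakPartial i u g ↔ ∀ (φ : Space d → ℝ) (h : IsTestFunction φ),
      ⟪(h.partialDeriv i).toL2, u⟫ = -⟪h.toL2, g⟫ := by
  simp only [IsTestFunction.inner_toL2]
  exact ⟨fun H => H.integral_eq, fun H => ⟨L2.locallyIntegrable u, L2.locallyIntegrable g, H⟩⟩

lemma IsWeakPartial.congr {i : Fin d} {u u' g g' : Space d → ℝ} (h : IsWeakPartial i u g)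
    (hu : u =ᵐ[volume] u') (hg : g =ᵐ[volume] g') : IsWeakPartial i u' g' := by
  refine ⟨h.1.congr hu, h.2.congr hg, fun φ hφ => ?_⟩
  have e1 : ∫ x, u x * NFPE.partialDeriv i φ x = ∫ x, u' x * NFPE.partialDeriv i φ x :=
    integral_congr_ae (by filter_upwards [hu] with x hx; rw [hx])
  have e2 : ∫ x, g x * φ x = ∫ x, g' x * φ x :=
    integral_congr_ae (by filter_upwards [hg] with x hx; rw [hx])
  rw [← e1, ← e2]
  exact h.3 φ hφ

/-- Weak derivatives are unique almost everywhere. -/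
lemma IsWeakPartial.unique {i : Fin d} {u g g' : Space d → ℝ} (h : IsWeakPartial i u g)
    (h' : IsWeakPartial i u g') : g =ᵐ[volume] g' := by
  refine ae_eq_of_integral_contDiff_smul_eq h.2 h'.2 fun φ h1 h2 => ?_
  have e1 := h.3 φ ⟨h1, h2⟩
  have e2 := h'.3 φ ⟨h1, h2⟩
  simp only [smul_eq_mul, mul_comm (φ _)]
  linarith

lemma dense_testFunction :
    Dense {f : L2 d | ∃ (φ : Space d → ℝ) (h : IsTestFunction φ), f = h.toL2} := by
  refine (MeasureTheory.Lp.dense_hasCompactSupport_contDiff (F := ℝ) (p := 2)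
    (μ := (volume : Measure (Space d))) (by norm_num)).mono ?_
  rintro f ⟨g, h1, h2, h3⟩
  refine ⟨g, ⟨h3, h2⟩, ?_⟩
  apply Lp.ext
  exact h1.trans (MemLp.coeFn_toLp _).symm

lemma hasDerivAt_integral_translate {f : Space d → ℝ} (hf : LocallyIntegrable f)
    {φ : Space d → ℝ} (h : IsTestFunction φ) (i : Fin d) (t : ℝ) :
    HasDerivAt (fun s : ℝ => ∫ x, f x * φ (x + s • EuclideanSpace.single i (1 : ℝ)))
      (∫ x, f x * NFPE.partialDeriv i φ (x + t • EuclideanSpace.single i (1 : ℝ))) t := by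
  set e : Space d := EuclideanSpace.single i (1 : ℝ) with he
  set ψ : Space d → ℝ := fun z => φ (-z) with hψ
  have hψs : ContDiff ℝ ∞ ψ := h.smooth.comp contDiff_neg
  have hψc : HasCompactSupport ψ := h.compact.comp_homeomorph (Homeomorph.neg (Space d))
  have key := hψc.hasFDerivAt_convolution_right (ContinuousLinearMap.mul ℝ ℝ) hf
    (hψs.of_le (by exact_mod_cast le_top)) (-(t • e))
  have hlin : HasDerivAt (fun s : ℝ => -(s • e)) (-e) t := by
    have := ((hasDerivAt_id t).smul_const e).neg
    rw [one_smul] at this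
    exact this
  have := key.comp_hasDerivAt t hlin
  have e1 : (fun s : ℝ => ∫ x, f x * φ (x + s • e)) =
      (convolution f ψ (ContinuousLinearMap.mul ℝ ℝ) volume ∘ fun s : ℝ => -(s • e)) := by
    ext s
    simp only [Function.comp, convolution_def, hψ, ContinuousLinearMap.mul_apply']
    congr 1; ext x; congr 2; abel
  have e2 : ∫ x, f x * NFPE.partialDeriv i φ (x + t • e) =
      (convolution f (fderiv ℝ ψ) (ContinuousLinearMap.precompR (Space d)
        (ContinuousLinearMap.mul ℝ ℝ)) volume (-(t • e))) (-e) := by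
    rw [convolution_precompR_apply _ hf (hψc.fderiv ℝ)
      (hψs.continuous_fderiv (by simp)), convolution_def]
    congr 1; ext x
    simp only [ContinuousLinearMap.mul_apply', NFPE.partialDeriv]
    congr 1
    have h2 : HasFDerivAt ψ ((fderiv ℝ φ (-(-(t • e) - x))).comp (-ContinuousLinearMap.id ℝ _))
        (-(t • e) - x) := by
      refine HasFDerivAt.comp _ ?_ (hasFDerivAt_id _).neg
      exact (h.smooth.differentiable (by simp) _).hasFDerivAt
    rw [h2.fderiv]
    simp only [ContinuousLinearMap.comp_apply, neg_apply,
      ContinuousLinearMap.id_apply, neg_neg]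
    congr 2; abel
  rw [e1, e2]
  exact this

/-- The translation `u ↦ u(· + v)` on `L²`. -/
def translateL2 (v : Space d) (u : L2 d) : L2 d :=
  Lp.compMeasurePreserving (fun x => x + v) (measurePreserving_add_right volume v) u

lemma coeFn_translateL2 (v : Space d) (u : L2 d) :
    translateL2 v u =ᵐ[volume] fun x => u (x + v) :=
  Lp.coeFn_compMeasurePreserving u (measurePreserving_add_right volume v)

lemma IsTestFunction.toL2_translate {φ : Space d → ℝ} (h : IsTestFunction φ) (v : Space d) :
    (h.translate v).toL2 = translateL2 v h.toL2 := by
  apply Lp.ext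
  refine (MemLp.coeFn_toLp _).trans (EventuallyEq.trans ?_ (coeFn_translateL2 v _).symm)
  exact ((measurePreserving_add_right volume v).quasiMeasurePreserving.ae_eq_comp
    h.memLp.coeFn_toLp).symm

lemma norm_translate (v : Space d) (u : L2 d) : ‖translateL2 v u‖ = ‖u‖ :=
  Lp.norm_compMeasurePreserving u (measurePreserving_add_right volume v)

lemma inner_translate (v : Space d) {φ : Space d → ℝ} (h : IsTestFunction φ) (u : L2 d) :
    ⟪h.toL2, translateL2 (-v) u - u⟫ = ⟪(h.translate v).toL2 - h.toL2, u⟫ := by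
  rw [inner_sub_left, inner_sub_right]
  congr 1
  rw [IsTestFunction.inner_toL2, IsTestFunction.inner_toL2,
    ← integral_add_right_eq_self (fun x => (translateL2 (-v) u) x * φ x) v]
  apply integral_congr_ae
  filter_upwards [(measurePreserving_add_right volume v).quasiMeasurePreserving.ae_eq_comp
    (coeFn_translateL2 (-v) u)] with x hx
  simp only [Function.comp, add_neg_cancel_right] at hx
  rw [hx]

lemma norm_le_of_forall_testFunction (w : L2 d) (C : ℝ) (hC : 0 ≤ C)
    (H : ∀ (φ : Space d → ℝ) (h : IsTestFunction φ), |⟪h.toL2, w⟫| ≤ C * ‖h.toL2‖) :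
    ‖w‖ ≤ C := by
  have hcl : IsClosed {f : L2 d | |⟪f, w⟫| ≤ C * ‖f‖} :=
    isClosed_le (by fun_prop) (by fun_prop)
  have h1 : |⟪w, w⟫| ≤ C * ‖w‖ := by
    have : closure {f : L2 d | ∃ (φ : Space d → ℝ) (h : IsTestFunction φ), f = h.toL2} ⊆
        {f : L2 d | |⟪f, w⟫| ≤ C * ‖f‖} :=
      closure_minimal (by rintro _ ⟨φ, h, rfl⟩; exact H φ h) hcl
    exact this (dense_testFunction w)
  rw [real_inner_self_eq_norm_sq, abs_of_nonneg (by positivity)] at h1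
  rcases (norm_nonneg w).eq_or_lt with h0 | h0
  · rw [← h0]
    exact hC
  · nlinarith

/-- An `L²` function with weak derivative `g` satisfies `‖u(· - t e_i) - u‖ ≤ |t| ‖g‖`. -/
lemma IsWeakPartial.norm_translate_sub_le {i : Fin d} {u g : L2 d} (h : IsWeakPartial i u g)
    (t : ℝ) : ‖translateL2 (-(t • EuclideanSpace.single i (1 : ℝ))) u - u‖ ≤ ‖g‖ * |t| := by
  refine norm_le_of_forall_testFunction _ _ (by positivity) fun φ hφ => ?_
  rw [inner_translate, inner_sub_left, IsTestFunction.inner_toL2, IsTestFunction.inner_toL2]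
  have hd := fun s : ℝ => hasDerivAt_integral_translate h.1 hφ i s
  have hb : ∀ s : ℝ,
      ‖∫ x, u x * NFPE.partialDeriv i φ (x + s • EuclideanSpace.single i (1 : ℝ))‖
        ≤ ‖g‖ * ‖hφ.toL2‖ := by
    intro s
    have ht := hφ.translate (s • EuclideanSpace.single i (1 : ℝ))
    have e1 : ∀ x, NFPE.partialDeriv i
        (fun x => φ (x + s • EuclideanSpace.single i (1 : ℝ))) x =
        NFPE.partialDeriv i φ (x + s • EuclideanSpace.single i (1 : ℝ)) := by
      intro x
      simp only [NFPE.partialDeriv]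
      rw [fderiv_comp_add_right]
    have e2 := h.3 _ ht
    simp only [e1] at e2
    rw [e2, norm_neg, ← ht.inner_toL2, mul_comm, ← norm_translate _ hφ.toL2,
      ← hφ.toL2_translate]
    exact norm_inner_le_norm _ _
  have := Convex.norm_image_sub_le_of_norm_hasDerivWithin_le
    (fun s _ => (hd s).hasDerivWithinAt) (fun s _ => hb s) convex_univ
    (Set.mem_univ 0) (Set.mem_univ t)
  simp only [zero_smul, add_zero, sub_zero, Real.norm_eq_abs] at this
  calc _ ≤ _ := this
    _ = _ := by ring

lemma translate_compLp {β : ℝ → ℝ} {K : ℝ≥0} (hβ : LipschitzWith K β) (h0 : β 0 = 0)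
    (v : Space d) (u : L2 d) :
    translateL2 v (hβ.compLp h0 u) = hβ.compLp h0 (translateL2 v u) := by
  apply Lp.ext
  refine (coeFn_translateL2 v _).trans (EventuallyEq.trans ?_ (hβ.coeFn_compLp h0 _).symm)
  filter_upwards [coeFn_translateL2 v u,
    (measurePreserving_add_right volume v).quasiMeasurePreserving.ae_eq_comp
      (hβ.coeFn_compLp h0 u)] with x h1 h2
  simp only [Function.comp] at h2 ⊢
  rw [h2, h1]

/-- Test functions as a vector space. -/
def testSubmodule (d : ℕ) : Submodule ℝ (Space d → ℝ) where
  carrier := {φ | IsTestFunction φ}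
  add_mem' := fun h h' => h.add h'
  zero_mem' := IsTestFunction.zero
  smul_mem' := fun c _ h => h.smul c

/-- If `u ∈ L²` has an `L²` weak derivative and `β` is Lipschitz with `β(0) = 0`, then
`β ∘ u` has an `L²` weak derivative. -/
lemma exists_isWeakPartial_compLp {i : Fin d} {u g : L2 d} (h : IsWeakPartial i u g)
    {β : ℝ → ℝ} {K : ℝ≥0} (hβ : LipschitzWith K β) (h0 : β 0 = 0) :
    ∃ g' : L2 d, IsWeakPartial i (hβ.compLp h0 u) g' := by
  set v : L2 d := hβ.compLp h0 u with hv
  have hbound : ∀ φ (hφ : IsTestFunction φ),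
      ‖∫ x, v x * NFPE.partialDeriv i φ x‖ ≤ K * ‖g‖ * ‖hφ.toL2‖ := by
    intro φ hφ
    have hd := hasDerivAt_integral_translate (L2.locallyIntegrable v) hφ i 0
    simp only [zero_smul, add_zero] at hd
    refine hd.le_of_lip' (by positivity) (Eventually.of_forall fun t => ?_)
    have ht := hφ.translate (t • EuclideanSpace.single i (1 : ℝ))
    simp only [zero_smul, add_zero, sub_zero]
    rw [← ht.inner_toL2, ← hφ.inner_toL2, ← inner_sub_left, ← inner_translate]
    calc _ ≤ _ := norm_inner_le_norm _ _
      _ ≤ ‖hφ.toL2‖ * (K * (‖g‖ * |t|)) := by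
        gcongr
        rw [hv, translate_compLp]
        exact (hβ.norm_compLp_sub_le h0 _ _).trans (by gcongr; exact h.norm_translate_sub_le t)
      _ = _ := by rw [Real.norm_eq_abs]; ring
  let j : testSubmodule d →ₗ[ℝ] L2 d :=
    { toFun := fun φ => IsTestFunction.toL2 φ.2
      map_add' := fun φ ψ => MemLp.toLp_add _ _
      map_smul' := fun c φ => MemLp.toLp_const_smul _ _ }
  let T : testSubmodule d →ₗ[ℝ] ℝ :=
    { toFun := fun φ => ⟪(IsTestFunction.partialDeriv φ.2 i).toL2, v⟫
      map_add' := fun φ ψ => by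
        rw [← inner_add_left]
        congr 1
        rw [IsTestFunction.toL2, IsTestFunction.toL2, IsTestFunction.toL2, ← MemLp.toLp_add]
        congr 1
        ext x
        simp only [NFPE.partialDeriv, Submodule.coe_add, Pi.add_apply]
        rw [fderiv_add (φ.2.smooth.differentiable (by simp) x)
          (ψ.2.smooth.differentiable (by simp) x)]
        rfl
      map_smul' := fun c φ => by
        rw [RingHom.id_apply, smul_eq_mul, ← real_inner_smul_left]
        congr 1
        rw [IsTestFunction.toL2, IsTestFunction.toL2, ← MemLp.toLp_const_smul]
        congr 1
        ext x
        simp only [NFPE.partialDeriv, Submodule.coe_smul, Pi.smul_apply]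
        rw [fderiv_const_smul (φ.2.smooth.differentiable (by simp) x)]
        rfl }
  have hdense : DenseRange j := by
    refine (dense_testFunction (d := d)).mono ?_
    rintro _ ⟨φ, hφ, rfl⟩
    exact ⟨⟨φ, hφ⟩, rfl⟩
  have hT : ∀ φ, ‖T φ‖ ≤ (K * ‖g‖) * ‖j φ‖ := by
    intro φ
    have := hbound φ.1 φ.2
    rw [← (IsTestFunction.partialDeriv φ.2 i).inner_toL2] at this
    exact this
  let g₀ : L2 d := (InnerProductSpace.toDual ℝ (L2 d)).symm (T.extendOfNorm j)
  refine ⟨-g₀, (isWeakPartial_iff i v (-g₀)).2 fun φ hφ => ?_⟩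
  rw [inner_neg_right, neg_neg, real_inner_comm _ hφ.toL2, InnerProductSpace.toDual_symm_apply]
  exact (LinearMap.extendOfNorm_eq hdense ⟨_, hT⟩ ⟨φ, hφ⟩).symm

/-- The `i`-th component of an `L²` vector field. -/
def L2Vec.component (i : Fin d) (G : L2Vec d) : L2 d :=
  (EuclideanSpace.proj i : Space d →L[ℝ] ℝ).compLp G

lemma L2Vec.coeFn_component (i : Fin d) (G : L2Vec d) :
    L2Vec.component i G =ᵐ[volume] fun x => G x i :=
  (EuclideanSpace.proj i : Space d →L[ℝ] ℝ).coeFn_compLp' G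

lemma isWeakGradient_iff (u : L2 d) (G : L2Vec d) :
    IsWeakGradient u G ↔ ∀ i, IsWeakPartial i u (L2Vec.component i G) :=
  forall_congr' fun i =>
    ⟨fun h => h.congr (ae_eq_refl _) (L2Vec.coeFn_component i G).symm,
      fun h => h.congr (ae_eq_refl _) (L2Vec.coeFn_component i G)⟩

/-- A Lipschitz function vanishing at `0` acts on functions with `L²` weak gradient. -/
lemma exists_isWeakGradient_compLp {u : L2 d} {G : L2Vec d} (h : IsWeakGradient u G)
    {β : ℝ → ℝ} {K : ℝ≥0} (hβ : LipschitzWith K β) (h0 : β 0 = 0) :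
    ∃ G' : L2Vec d, IsWeakGradient (hβ.compLp h0 u) G' := by
  choose g' hg' using fun i =>
    exists_isWeakPartial_compLp ((isWeakGradient_iff u G).1 h i) hβ h0
  have hmem : MemLp (fun x => WithLp.toLp 2 (fun i => g' i x) : Space d → Space d) 2
      (volume : Measure (Space d)) :=
    MemLp.of_eval_piLp fun i => Lp.memLp (g' i)
  refine ⟨hmem.toLp _, fun i => (hg' i).congr (ae_eq_refl _) ?_⟩
  filter_upwards [hmem.coeFn_toLp] with x hx
  rw [hx]

lemma IsWeakGradient.unique {u : Space d → ℝ} {G G' : L2Vec d} (h : IsWeakGradient u G)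
    (h' : IsWeakGradient u G') : G = G' := by
  apply Lp.ext
  have := fun i => (h i).unique (h' i)
  filter_upwards [ae_all_iff.2 this] with x hx
  ext i
  exact hx i

end Aux

/-! ### The spaces `H¹` and `H⁻¹` -/

/-- The Sobolev space `H¹(ℝ^d)`, realised as the space of pairs `(u, ∇u)` of an `L²` function
and its weak gradient in `L²`, with the inner product
`⟪u, v⟫ = ∫ u v dx + ∫ ∇u · ∇v dx`. -/
def H1Submodule (d : ℕ) : Submodule ℝ (WithLp 2 (L2 d × L2Vec d)) where
  carrier := {p | IsWeakGradient p.fst p.snd}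
  add_mem' := by
    intro p q hp hq
    simp only [Set.mem_ofPred_eq, isWeakGradient_iff, isWeakPartial_iff] at *
    intro i φ h
    have e : L2Vec.component i (p + q).snd =
        L2Vec.component i p.snd + L2Vec.component i q.snd :=
      ((EuclideanSpace.proj i : Space d →L[ℝ] ℝ).compLpL 2 volume).map_add p.snd q.snd
    rw [e, WithLp.add_fst, inner_add_right, inner_add_right, hp i φ h, hq i φ h]
    ring
  zero_mem' := by
    simp only [Set.mem_ofPred_eq, isWeakGradient_iff, isWeakPartial_iff]
    intro i φ h
    have e : L2Vec.component i (0 : WithLp 2 (L2 d × L2Vec d)).snd = 0 :=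
      ((EuclideanSpace.proj i : Space d →L[ℝ] ℝ).compLpL 2 volume).map_zero
    rw [e, WithLp.zero_fst, inner_zero_right, inner_zero_right, neg_zero]
  smul_mem' := by
    intro c p hp
    simp only [Set.mem_ofPred_eq, isWeakGradient_iff, isWeakPartial_iff] at *
    intro i φ h
    have e : L2Vec.component i (c • p).snd = c • L2Vec.component i p.snd :=
      ((EuclideanSpace.proj i : Space d →L[ℝ] ℝ).compLpL 2 volume).map_smul c p.snd
    rw [e, WithLp.smul_fst, real_inner_smul_right, real_inner_smul_right, hp i φ h]
    ring

/-- The Hilbert space `H¹ = H¹(ℝ^d)`. -/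
def H1 (d : ℕ) : Type := H1Submodule d

instance instNormedAddCommGroupH1 (d : ℕ) : NormedAddCommGroup (H1 d) :=
  inferInstanceAs (NormedAddCommGroup (H1Submodule d))

instance instInnerProductSpaceH1 (d : ℕ) : InnerProductSpace ℝ (H1 d) :=
  inferInstanceAs (InnerProductSpace ℝ (H1Submodule d))

section Spaces

variable {d : ℕ}

/-- The continuous linear inclusion `H¹ ⊂ L²`. -/
def H1.valL (d : ℕ) : H1 d →L[ℝ] L2 d :=
  (WithLp.fstL 2 ℝ (L2 d) (L2Vec d)).comp (H1Submodule d).subtypeL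

/-- The weak gradient as a continuous linear map. -/
def H1.gradL (d : ℕ) : H1 d →L[ℝ] L2Vec d :=
  (WithLp.sndL 2 ℝ (L2 d) (L2Vec d)).comp (H1Submodule d).subtypeL

/-- The `L²` function underlying an element of `H¹`. -/
def H1.val (y : H1 d) : L2 d := H1.valL d y

/-- The weak gradient of an element of `H¹`. -/
def H1.grad (y : H1 d) : L2Vec d := H1.gradL d y

lemma H1.isWeakGradient (y : H1 d) : IsWeakGradient y.val y.grad := y.2

lemma H1.inner_eq (u v : H1 d) :
    ⟪u, v⟫ = (∫ x, u.val x * v.val x) + ∫ x, ⟪u.grad x, v.grad x⟫ := by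
  have h : ⟪u, v⟫ = ⟪u.val, v.val⟫ + ⟪u.grad, v.grad⟫ := rfl
  rw [h, MeasureTheory.L2.inner_def, MeasureTheory.L2.inner_def]
  simp only [RCLike.inner_apply, conj_trivial, mul_comm]

/-- An element of `H¹` is determined by its underlying function. -/
lemma H1.val_injective : Function.Injective (H1.val : H1 d → L2 d) := by
  intro u v h
  apply Subtype.ext
  apply WithLp.ofLp_injective
  have h2 := u.isWeakGradient
  rw [h] at h2
  exact Prod.ext h (h2.unique v.isWeakGradient)

lemma isClosed_H1Submodule : IsClosed (H1Submodule d : Set (WithLp 2 (L2 d × L2Vec d))) := by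
  have : (H1Submodule d : Set (WithLp 2 (L2 d × L2Vec d))) =
      ⋂ (i : Fin d) (φ : Space d → ℝ) (h : IsTestFunction φ),
        {p | ⟪(h.partialDeriv i).toL2, p.fst⟫ =
          -⟪h.toL2, (EuclideanSpace.proj i : Space d →L[ℝ] ℝ).compLpL 2 volume p.snd⟫} := by
    ext p
    simp only [Set.mem_iInter]
    exact (isWeakGradient_iff _ _).trans (forall_congr' fun i => isWeakPartial_iff i _ _)
  rw [this]
  refine isClosed_iInter fun i => isClosed_iInter fun φ => isClosed_iInter fun h => ?_
  have h1 : Continuous fun p : WithLp 2 (L2 d × L2Vec d) => p.fst :=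
    (WithLp.fstL 2 ℝ (L2 d) (L2Vec d)).continuous
  have h2 : Continuous fun p : WithLp 2 (L2 d × L2Vec d) => p.snd :=
    (WithLp.sndL 2 ℝ (L2 d) (L2Vec d)).continuous
  refine isClosed_eq (continuous_const.inner h1) (continuous_const.inner ?_).neg
  exact (ContinuousLinearMap.continuous _).comp h2

instance instCompleteSpaceH1 : CompleteSpace (H1 d) :=
  (isClosed_H1Submodule (d := d)).completeSpace_coe

end Spaces

/-- `H⁻¹ = H⁻¹(ℝ^d)`, the dual space of `H¹`; `y φ` is the duality pairing of `y ∈ H⁻¹` and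
`φ ∈ H¹`. -/
abbrev HNeg1 (d : ℕ) := StrongDual ℝ (H1 d)

section Dual

variable {d : ℕ}

/-- The operator `I - Δ : H¹ → H⁻¹`, `((I - Δ) u) φ = ∫ u φ dx + ∫ ∇u · ∇φ dx`, which is an
isomorphism. -/
def oneSubLaplacian (d : ℕ) : H1 d ≃ₗᵢ[ℝ] HNeg1 d := InnerProductSpace.toDual ℝ (H1 d)

lemma oneSubLaplacian_apply (u φ : H1 d) :
    oneSubLaplacian d u φ = (∫ x, u.val x * φ.val x) + ∫ x, ⟪u.grad x, φ.grad x⟫ :=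
  H1.inner_eq u φ

/-- The scalar product `⟪y₁, y₂⟫ = ((I - Δ)⁻¹ y₁, y₂)` of `H⁻¹`, where `(·, ·)` is the duality
pairing extending the inner product of `L²`. -/
instance instInnerProductSpaceHNeg1 : InnerProductSpace ℝ (HNeg1 d) where
  inner y₁ y₂ := y₂ ((oneSubLaplacian d).symm y₁)
  norm_sq_eq_re_inner y := by
    have h : y ((oneSubLaplacian d).symm y) =
        oneSubLaplacian d ((oneSubLaplacian d).symm y) ((oneSubLaplacian d).symm y) := by
      rw [LinearIsometryEquiv.apply_symm_apply]
    change ‖y‖ ^ 2 = y ((oneSubLaplacian d).symm y)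
    rw [h, ← (oneSubLaplacian d).symm.norm_map y]
    exact (real_inner_self_eq_norm_sq _).symm
  conj_inner_symm y₁ y₂ := by
    have h : ∀ z₁ z₂ : HNeg1 d, z₂ ((oneSubLaplacian d).symm z₁) =
        ⟪(oneSubLaplacian d).symm z₂, (oneSubLaplacian d).symm z₁⟫ := by
      intro z₁ z₂
      conv_lhs => rw [← (oneSubLaplacian d).apply_symm_apply z₂]
      rfl
    change y₁ ((oneSubLaplacian d).symm y₂) = y₂ ((oneSubLaplacian d).symm y₁)
    rw [h, h, real_inner_comm]
  add_left y₁ y₂ y₃ := by simp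
  smul_left y₁ y₂ c := by simp

lemma HNeg1.inner_def (y₁ y₂ : HNeg1 d) : ⟪y₁, y₂⟫ = y₂ ((oneSubLaplacian d).symm y₁) := rfl

/-- The element `φ ↦ ∫ F · ∇φ dx` of `H⁻¹` (that is, `-div F`) for `F ∈ L²(ℝ^d; ℝ^d)`. -/
def negDiv (F : L2Vec d) : HNeg1 d :=
  (innerSL ℝ F).comp (H1.gradL d)

/-- The inclusion `L² ⊂ H⁻¹`, `u ↦ (φ ↦ ∫ u φ dx)`. -/
def L2.toHNeg1 (u : L2 d) : HNeg1 d :=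
  (innerSL ℝ u).comp (H1.valL d)

lemma negDiv_apply (F : L2Vec d) (φ : H1 d) : negDiv F φ = ∫ x, ⟪F x, φ.grad x⟫ :=
  MeasureTheory.L2.inner_def F φ.grad

lemma L2.toHNeg1_apply (u : L2 d) (φ : H1 d) : L2.toHNeg1 u φ = ∫ x, u x * φ.val x := by
  refine (MeasureTheory.L2.inner_def u φ.val).trans ?_
  simp only [RCLike.inner_apply, conj_trivial, mul_comm]

/-- The inclusion `H¹ ⊂ L² ⊂ H⁻¹`. -/
def H1.toHNeg1 (y : H1 d) : HNeg1 d := L2.toHNeg1 y.val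

lemma H1.toHNeg1_apply (y φ : H1 d) : y.toHNeg1 φ = ∫ x, y.val x * φ.val x :=
  L2.toHNeg1_apply y.val φ

lemma H1.toHNeg1_injective : Function.Injective (H1.toHNeg1 : H1 d → HNeg1 d) := by
  intro u v h
  apply H1.val_injective
  have h1 : u.toHNeg1 (u - v) = v.toHNeg1 (u - v) := by rw [h]
  have h2 : ⟪u.val - v.val, u.val - v.val⟫ = 0 := by
    rw [inner_sub_left, sub_eq_zero]
    exact h1
  exact sub_eq_zero.1 (inner_self_eq_zero.1 h2)

end Dual

/-! ### Accretive operators in a Hilbert space -/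

section Accretive

variable {H : Type*} [NormedAddCommGroup H] [InnerProductSpace ℝ H]

/-- The operator `B : D ⊂ H → H` is `m`-accretive: `(B u₁ - B u₂, u₁ - u₂) ≥ 0` on its domain `D`
and `R(I + λ B) = H` for all `λ > 0`. -/
def IsMAccretive (D : Set H) (B : D → H) : Prop :=
  (∀ u₁ u₂ : D, 0 ≤ ⟪B u₁ - B u₂, (u₁ : H) - (u₂ : H)⟫) ∧
    ∀ r : ℝ, 0 < r → ∀ f : H, ∃ u : D, (u : H) + r • B u = f

/-- The operator `B : D ⊂ H → H` is quasi-`m`-accretive: `B + c I` is `m`-accretive for some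
`c ≥ 0`. -/
def IsQuasiMAccretive (D : Set H) (B : D → H) : Prop :=
  ∃ c : ℝ, 0 ≤ c ∧ IsMAccretive D (fun u => B u + c • (u : H))

end Accretive

/-! ### The data of the equation and the operator `A*` -/

/-- `β ∈ C¹(ℝ)`, `β(0) = 0`, `0 < γ₁ ≤ β' ≤ γ₂`. -/
structure HypBeta (β : ℝ → ℝ) : Prop where
  contDiff : ContDiff ℝ 1 β
  map_zero : β 0 = 0
  deriv_bounds : ∃ γ₁ γ₂ : ℝ, 0 < γ₁ ∧ ∀ r, γ₁ ≤ deriv β r ∧ deriv β r ≤ γ₂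

/-- `b ∈ C_b(ℝ) ∩ C¹(ℝ)`, `b ≥ b₀ > 0` and `|b'(r) r + b(r)| ≤ γ₃`. -/
structure HypB (b : ℝ → ℝ) : Prop where
  contDiff : ContDiff ℝ 1 b
  bounded : ∃ M : ℝ, ∀ r, |b r| ≤ M
  lower_bound : ∃ b₀ : ℝ, 0 < b₀ ∧ ∀ r, b₀ ≤ b r
  deriv_bound : ∃ γ₃ : ℝ, ∀ r, |deriv b r * r + b r| ≤ γ₃

/-- `D ∈ L^∞(ℝ^d; ℝ^d) ∩ W^{1,1}_loc(ℝ^d; ℝ^d)` and `div D ∈ L²(ℝ^d) + L^∞(ℝ^d)`.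
Here `J i` is the weak gradient of the `i`-th component of `D`. -/
structure HypD {d : ℕ} (D : Space d → Space d) : Prop where
  memLp_top : MemLp D ∞
  weakly_differentiable : ∃ J : Fin d → Space d → Space d,
    (∀ i, IsWeakGradient (fun x => D x i) (J i)) ∧
    ∃ f g : Space d → ℝ, MemLp f 2 ∧ MemLp g ∞ ∧
      (fun x => ∑ i, J i x i) =ᵐ[volume] fun x => f x + g x

/-- `D = -∇Φ` with `Φ ∈ C(ℝ^d) ∩ W^{2,1}_loc(ℝ^d)`, `Φ ≥ 1`, `Φ(x) → +∞` as `|x| → ∞` and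
`Φ^{-m} ∈ L¹(ℝ^d)` for some `m ≥ 2`. -/
structure HypPhi {d : ℕ} (D : Space d → Space d) (Φ : Space d → ℝ) : Prop where
  continuous : Continuous Φ
  weakly_differentiable : ∃ G : Space d → Space d, IsWeakGradient Φ G ∧
    (∀ i, ∃ G' : Space d → Space d, IsWeakGradient (fun x => G x i) G') ∧
    D =ᵐ[volume] fun x => -G x
  one_le : ∀ x, 1 ≤ Φ x
  tendsto : Tendsto Φ (cocompact (Space d)) atTop
  integrable : ∃ m : ℝ, 2 ≤ m ∧ Integrable fun x => Φ x ^ (-m)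

/-- The standing hypotheses on `β`, `b`, `D` and `Φ`. -/
structure Hypotheses {d : ℕ} (β b : ℝ → ℝ) (D : Space d → Space d) (Φ : Space d → ℝ) :
    Prop where
  hypBeta : HypBeta β
  hypB : HypB b
  hypD : HypD D
  hypPhi : HypPhi D Φ

/-- `b*(r) = b(r) r`. -/
def bStar (b : ℝ → ℝ) (r : ℝ) : ℝ := b r * r

section Operator

variable {d : ℕ} {β b : ℝ → ℝ} {D : Space d → Space d} {Φ : Space d → ℝ}

lemma HypBeta.exists_lipschitz (h : HypBeta β) : ∃ K : ℝ≥0, LipschitzWith K β := by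
  obtain ⟨γ₁, γ₂, h1, h2⟩ := h.deriv_bounds
  have hγ : 0 ≤ γ₂ := (h1.le.trans (h2 0).1).trans (h2 0).2
  refine ⟨γ₂.toNNReal, lipschitzWith_of_nnnorm_deriv_le (h.contDiff.differentiable (by simp)) ?_⟩
  intro r
  rw [← NNReal.coe_le_coe, coe_nnnorm, Real.norm_eq_abs, Real.coe_toNNReal _ hγ,
    abs_of_nonneg (h1.le.trans (h2 r).1)]
  exact (h2 r).2

/-- If `y ∈ H¹` then `β(y) ∈ H¹`. -/
lemma HypBeta.exists_comp (h : HypBeta β) (y : H1 d) :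
    ∃ z : H1 d, z.val =ᵐ[volume] fun x => β (y.val x) := by
  obtain ⟨K, hK⟩ := h.exists_lipschitz
  obtain ⟨G, hG⟩ := exists_isWeakGradient_compLp y.isWeakGradient hK h.map_zero
  exact ⟨⟨WithLp.toLp 2 (hK.compLp h.map_zero y.val, G), hG⟩, hK.coeFn_compLp h.map_zero y.val⟩

/-- The element `β(y)` of `H¹`, for `y ∈ H¹` (an element of `H¹` is determined by its underlying
function, so this does not depend on the choice). -/
def betaComp (h : HypBeta β) (y : H1 d) : H1 d := (h.exists_comp y).choose

lemma betaComp_val (h : HypBeta β) (y : H1 d) :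
    (betaComp h y).val =ᵐ[volume] fun x => β (y.val x) :=
  (h.exists_comp y).choose_spec

/-- If `y ∈ L²` then `D b*(y) ∈ L²`. -/
lemma memLp_drift (hb : HypB b) (hD : HypD D) (y : L2 d) :
    MemLp (fun x => bStar b (y x) • D x) 2 (volume : Measure (Space d)) := by
  obtain ⟨M, hM⟩ := hb.bounded
  have h1 : MemLp (fun x => bStar b (y x)) 2 (volume : Measure (Space d)) := by
    refine (Lp.memLp y).of_le_mul (c := M) ?_ (Eventually.of_forall fun x => ?_)
    · exact (hb.contDiff.continuous.mul continuous_id).comp_aestronglyMeasurable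
        (Lp.memLp y).aestronglyMeasurable
    · rw [bStar, norm_mul]
      exact mul_le_mul_of_nonneg_right (hM _) (norm_nonneg _)
  exact hD.memLp_top.smul h1

/-- The operator `A* : H¹ → H⁻¹`, `A* y = -Δ β(y) + div (D b*(y))`, that is,
`(A* y) φ = ∫ (∇β(y) - D b*(y)) · ∇φ dx` for all `φ ∈ H¹`. -/
def AStar (h : Hypotheses β b D Φ) (y : H1 d) : HNeg1 d :=
  negDiv ((betaComp h.hypBeta y).grad - (memLp_drift h.hypB h.hypD y.val).toLp _)

lemma AStar_apply (h : Hypotheses β b D Φ) (y φ : H1 d) :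
    AStar h y φ =
      ∫ x, ⟪(betaComp h.hypBeta y).grad x - bStar b (y.val x) • D x, φ.grad x⟫ := by
  rw [AStar, negDiv_apply]
  apply integral_congr_ae
  filter_upwards [Lp.coeFn_sub (betaComp h.hypBeta y).grad
    ((memLp_drift h.hypB h.hypD y.val).toLp _),
    (memLp_drift h.hypB h.hypD y.val).coeFn_toLp] with x h1 h2
  rw [h1, Pi.sub_apply, h2]

/-- The domain `D(A*) = H¹`, as a subset of `H⁻¹`. -/
def AStarDomain (d : ℕ) : Set (HNeg1 d) := Set.range (H1.toHNeg1 : H1 d → HNeg1 d)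

/-- `A*` as an operator `D(A*) ⊂ H⁻¹ → H⁻¹`. -/
def AStarOp (h : Hypotheses β b D Φ) (u : AStarDomain d) : HNeg1 d :=
  AStar h ((Equiv.ofInjective _ H1.toHNeg1_injective).symm u)

lemma AStarOp_apply (h : Hypotheses β b D Φ) (y : H1 d) :
    AStarOp h ⟨y.toHNeg1, y, rfl⟩ = AStar h y := by
  rw [AStarOp]
  congr 1
  exact (Equiv.ofInjective _ H1.toHNeg1_injective).symm_apply_apply y

end Operator

end

end NFPE

namespace NFPE

open MeasureTheory Filter Topology
open scoped ContDiff ENNReal NNReal RealInnerProductSpace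

noncomputable section

/-! The `H⁻¹` product of `A* u - A* v` with `u - v` is `A* u - A* v` tested against `w = (I - Δ)⁻¹(u
- v)`. Writing `-Δ = (I - Δ) - I`, it equals `⟪β(u) - β(v), u - v⟫ - ⟪β(u) - β(v), w⟫ - ⟪D(b*(u) -
b*(v)), ∇w⟫`, all products being in `L²`. The first term dominates `γ‖u - v‖²` because `β' ≥ γ > 0`.
The other two are at most `const · ‖u - v‖ ‖w‖`, since `β` and `b*` are Lipschitz and `D` is
bounded. Young's inequality absorbs them at the price of a multiple of `‖w‖²`, where the `H¹` norm
of `w` is the `H⁻¹` norm of `u - v`. This is the Gårding inequality `exists_garding`; accretivity of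
`A* + cI` follows at once.

For the range, applying `(I - Δ)⁻¹` to `A* y + μ y = f` gives `β(y) + Z(y) = (I - Δ)⁻¹ f`, which
makes sense for `y` merely in `L²`. The left side is Lipschitz on `L²`, and by the same Gårding
inequality strongly monotone when `μ ≥ c`, so Zarantonello's theorem yields a solution
(`exists_resolvent_L2`). The equation itself then shows `β(y) ∈ H¹`, and `y = β⁻¹(β(y)) ∈ H¹`
because `β⁻¹` is Lipschitz (`HypBeta.exists_of_comp`). -/

/-! ### Strongly monotone operators in Hilbert space. -/

/-- Zarantonello's theorem: a Lipschitz and strongly monotone operator on a Hilbert space is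
surjective. -/
theorem surjective_of_stronglyMonotone_of_lipschitz {H : Type*} [NormedAddCommGroup H]
    [InnerProductSpace ℝ H] [CompleteSpace H] {F : H → H} {m L : ℝ} (hm : 0 < m)
    (hmono : ∀ x y, m * ‖x - y‖ ^ 2 ≤ ⟪F x - F y, x - y⟫)
    (hlip : ∀ x y, ‖F x - F y‖ ≤ L * ‖x - y‖) : Function.Surjective F := by
  intro f
  -- Enlarging the Lipschitz constant beyond `m` gives `0 < m < M` whatever `L` is, so `1 - m²/M²`
  -- lies in `(0, 1)`.
  set M : ℝ := max L (m + 1)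
  have hM : m < M := (lt_add_one m).trans_le (le_max_right _ _)
  have hM0 : 0 < M := hm.trans hM
  -- This step size minimises `1 - 2tm + t²M²`, the bound for the squared contraction factor of `G`;
  -- the minimum is `1 - m²/M²`.
  set t : ℝ := m / M ^ 2
  have ht : 0 < t := by positivity
  have hq : 0 ≤ 1 - m ^ 2 / M ^ 2 := by
    rw [sub_nonneg, div_le_one (by positivity)]
    gcongr
  set G : H → H := fun y => y - t • (F y - f)
  have hG : ContractingWith (Real.sqrt (1 - m ^ 2 / M ^ 2)).toNNReal G := by
    refine ⟨?_, LipschitzWith.of_dist_le_mul fun x y => ?_⟩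
    · rw [Real.toNNReal_lt_one, Real.sqrt_lt' one_pos]
      have : 0 < m ^ 2 / M ^ 2 := by positivity
      linarith
    · rw [Real.coe_toNNReal _ (Real.sqrt_nonneg _), dist_eq_norm, dist_eq_norm]
      refine le_of_sq_le_sq ?_ (by positivity)
      rw [mul_pow, Real.sq_sqrt hq]
      have e : G x - G y = (x - y) - t • (F x - F y) := by
        simp only [G, smul_sub]
        abel
      have h1 : ‖F x - F y‖ ^ 2 ≤ M ^ 2 * ‖x - y‖ ^ 2 := by
        rw [← mul_pow]
        have : L * ‖x - y‖ ≤ M * ‖x - y‖ := by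
          gcongr
          exact le_max_left _ _
        gcongr
        exact (hlip x y).trans this
      rw [e, norm_sub_sq_real, norm_smul, real_inner_smul_right, mul_pow, Real.norm_eq_abs,
        sq_abs, real_inner_comm]
      have h2 := mul_le_mul_of_nonneg_left (hmono x y) ht.le
      have h3 := mul_le_mul_of_nonneg_left h1 (sq_nonneg t)
      have h4 : t * (m * ‖x - y‖ ^ 2) = m ^ 2 / M ^ 2 * ‖x - y‖ ^ 2 := by
        simp only [t]
        field_simp
      have h5 : t ^ 2 * (M ^ 2 * ‖x - y‖ ^ 2) = m ^ 2 / M ^ 2 * ‖x - y‖ ^ 2 := by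
        simp only [t]
        field_simp
      linarith
  have hfix : G (hG.fixedPoint G) = hG.fixedPoint G := hG.fixedPoint_isFixedPt
  refine ⟨hG.fixedPoint G, ?_⟩
  have h0 : t • (F (hG.fixedPoint G) - f) = 0 := sub_eq_self.1 hfix
  exact sub_eq_zero.1 ((smul_eq_zero.1 h0).resolve_left ht.ne')

/-! ### Monotonicity and Lipschitz bounds for `β`, `β⁻¹` and `b*`. -/

section ScalarFunctions

variable {β b : ℝ → ℝ}

lemma HypBeta.strongly_increasing (h : HypBeta β) :
    ∃ γ : ℝ, 0 < γ ∧ ∀ r s, γ * (r - s) ^ 2 ≤ (β r - β s) * (r - s) := by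
  obtain ⟨γ₁, γ₂, h1, h2⟩ := h.deriv_bounds
  have hd : Differentiable ℝ β := h.contDiff.differentiable (by simp)
  have key : ∀ r s, s ≤ r → γ₁ * (r - s) ≤ β r - β s := fun r s hrs =>
    mul_sub_le_image_sub_of_le_deriv hd (fun x => (h2 x).1) hrs
  refine ⟨γ₁, h1, fun r s => ?_⟩
  rcases le_total s r with hrs | hrs
  · have := mul_le_mul_of_nonneg_right (key r s hrs) (sub_nonneg.2 hrs)
    linarith
  · have := mul_le_mul_of_nonneg_right (key s r hrs) (sub_nonneg.2 hrs)
    linarith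

/-- `β` has a Lipschitz inverse. -/
lemma HypBeta.exists_lipschitz_inverse (h : HypBeta β) :
    ∃ (K : ℝ≥0) (α : ℝ → ℝ), LipschitzWith K α ∧ α 0 = 0 ∧ (∀ r, α (β r) = r) := by
  obtain ⟨γ, hγ, hinc⟩ := h.strongly_increasing
  have hlow : ∀ r s, γ * |r - s| ≤ |β r - β s| := by
    intro r s
    rcases (abs_nonneg (r - s)).eq_or_lt with h0 | h0
    · rw [← h0, mul_zero]
      exact abs_nonneg _
    · refine le_of_mul_le_mul_right ?_ h0
      calc γ * |r - s| * |r - s| = γ * (r - s) ^ 2 := by rw [mul_assoc, abs_mul_abs_self, sq]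
        _ ≤ (β r - β s) * (r - s) := hinc r s
        _ ≤ |(β r - β s) * (r - s)| := le_abs_self _
        _ = |β r - β s| * |r - s| := abs_mul _ _
  obtain ⟨K, hK⟩ := h.exists_lipschitz
  -- Surjectivity is the one-dimensional case of Zarantonello's theorem.
  have hsurj : Function.Surjective β := by
    refine surjective_of_stronglyMonotone_of_lipschitz (m := γ) (L := K) hγ (fun x y => ?_)
      fun x y => ?_
    · rw [Real.norm_eq_abs, sq_abs]
      simpa [mul_comm] using hinc x y
    · exact hK.norm_sub_le x y
  have hinj : Function.Injective β := by
    intro r s hrs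
    have := hlow r s
    rw [hrs, sub_self, abs_zero] at this
    have h0 : |r - s| = 0 := le_antisymm (by nlinarith [abs_nonneg (r - s)]) (abs_nonneg _)
    exact sub_eq_zero.1 (abs_eq_zero.1 h0)
  set e := Equiv.ofBijective β ⟨hinj, hsurj⟩
  have he : ∀ r, e.symm (β r) = r := e.symm_apply_apply
  refine ⟨γ⁻¹.toNNReal, e.symm, LipschitzWith.of_dist_le_mul fun x y => ?_, ?_, he⟩
  · obtain ⟨r, rfl⟩ := hsurj x
    obtain ⟨s, rfl⟩ := hsurj y
    rw [he, he, Real.coe_toNNReal _ (by positivity), Real.dist_eq, Real.dist_eq,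
      inv_mul_eq_div, le_div_iff₀ hγ, mul_comm]
    exact hlow r s
  · simpa only [h.map_zero] using he 0

/-- The quantity `b'(r) r + b(r)` bounded in the hypothesis is exactly the derivative of `b*`. -/
lemma HypB.exists_lipschitz (h : HypB b) : ∃ K : ℝ≥0, LipschitzWith K (bStar b) := by
  obtain ⟨γ₃, hγ⟩ := h.deriv_bound
  have hb : Differentiable ℝ b := h.contDiff.differentiable (by simp)
  have hd : ∀ r, HasDerivAt (bStar b) (deriv b r * r + b r) r := fun r => by
    have := (hb r).hasDerivAt.mul (hasDerivAt_id r)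
    rw [mul_one] at this
    exact this
  refine ⟨γ₃.toNNReal, lipschitzWith_of_nnnorm_deriv_le (fun r => (hd r).differentiableAt)
    fun r => ?_⟩
  rw [(hd r).deriv, ← NNReal.coe_le_coe, coe_nnnorm]
  exact (hγ r).trans (Real.le_coe_toNNReal _)

end ScalarFunctions

/-! ### Superposition operators on `L²`. -/

section Nemytskii

variable {d : ℕ} {β b : ℝ → ℝ} {D : Space d → Space d}

lemma le_inner_compLp_sub {K : ℝ≥0} (hK : LipschitzWith K β) (h0 : β 0 = 0) {γ : ℝ}
    (hinc : ∀ r s, γ * (r - s) ^ 2 ≤ (β r - β s) * (r - s)) (u v : L2 d) :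
    γ * ‖u - v‖ ^ 2 ≤ ⟪hK.compLp h0 u - hK.compLp h0 v, u - v⟫ := by
  rw [← real_inner_self_eq_norm_sq, ← real_inner_smul_left, MeasureTheory.L2.inner_def,
    MeasureTheory.L2.inner_def]
  refine integral_mono_ae (L2.integrable_inner _ _) (L2.integrable_inner _ _) ?_
  filter_upwards [Lp.coeFn_sub u v, Lp.coeFn_sub (hK.compLp h0 u) (hK.compLp h0 v),
    Lp.coeFn_smul γ (u - v), hK.coeFn_compLp h0 u, hK.coeFn_compLp h0 v] with x h1 h2 h3 h4 h5
  have := hinc (u x) (v x)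
  simp only [h2, h3, Pi.smul_apply, Pi.sub_apply, h1, h4, h5, Function.comp,
    RCLike.inner_apply, conj_trivial, smul_eq_mul]
  linarith

/-- The map `u ↦ D b*(u)` from `L²` to `L²(ℝ^d; ℝ^d)`. -/
def drift (hb : HypB b) (hD : HypD D) (u : L2 d) : L2Vec d := (memLp_drift hb hD u).toLp _

/-- Pointwise, the difference is `(b*(u) - b*(v)) D`, so the Lipschitz constant of `b*` times the
essential supremum of `|D|` suffices. -/
lemma exists_lipschitz_drift (hb : HypB b) (hD : HypD D) :
    ∃ C : ℝ≥0, LipschitzWith C (drift hb hD) := by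
  obtain ⟨K, hK⟩ := hb.exists_lipschitz
  set M : ℝ := (eLpNorm D ⊤ volume).toReal
  have hM : ∀ᵐ x, ‖D x‖ ≤ M := by
    have htop : eLpNorm D ⊤ volume ≠ ⊤ := hD.memLp_top.2.ne
    filter_upwards [ae_le_eLpNormEssSup (f := D) (μ := (volume : Measure (Space d)))] with x hx
    rw [← eLpNorm_exponent_top] at hx
    have := ENNReal.toReal_mono htop hx
    rwa [toReal_enorm] at this
  refine ⟨K * M.toNNReal, LipschitzWith.of_dist_le_mul fun u v => ?_⟩
  rw [dist_eq_norm, dist_eq_norm, NNReal.coe_mul, Real.coe_toNNReal _ ENNReal.toReal_nonneg]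
  refine Lp.norm_le_mul_norm_of_ae_le_mul ?_
  filter_upwards [Lp.coeFn_sub u v, Lp.coeFn_sub (drift hb hD u) (drift hb hD v),
    (memLp_drift hb hD u).coeFn_toLp, (memLp_drift hb hD v).coeFn_toLp, hM] with x h1 h2 h3 h4 h5
  have h3' : drift hb hD u x = bStar b (u x) • D x := h3
  have h4' : drift hb hD v x = bStar b (v x) • D x := h4
  rw [h2, h1, Pi.sub_apply, Pi.sub_apply, h3', h4', ← sub_smul, norm_smul]
  calc _ ≤ (K * ‖u x - v x‖) * M := by
        gcongr
        exact hK.norm_sub_le _ _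
    _ = _ := by ring

end Nemytskii

/-! ### Duality between `L²`, `H¹` and `H⁻¹`, and the weak form of `A*`. -/

section Resolvent

variable {d : ℕ} {β b : ℝ → ℝ} {D : Space d → Space d} {Φ : Space d → ℝ}

lemma H1.inner_eq_add (u v : H1 d) :
    ⟪u, v⟫ = ⟪H1.valL d u, H1.valL d v⟫ + ⟪H1.gradL d u, H1.gradL d v⟫ :=
  rfl

lemma H1.norm_valL_le (u : H1 d) : ‖H1.valL d u‖ ≤ ‖u‖ := by
  refine le_of_sq_le_sq ?_ (norm_nonneg u)
  rw [← real_inner_self_eq_norm_sq u, H1.inner_eq_add, real_inner_self_eq_norm_sq,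
    real_inner_self_eq_norm_sq]
  nlinarith [sq_nonneg ‖H1.gradL d u‖]

lemma H1.norm_gradL_le (u : H1 d) : ‖H1.gradL d u‖ ≤ ‖u‖ := by
  refine le_of_sq_le_sq ?_ (norm_nonneg u)
  rw [← real_inner_self_eq_norm_sq u, H1.inner_eq_add, real_inner_self_eq_norm_sq,
    real_inner_self_eq_norm_sq]
  nlinarith [sq_nonneg ‖H1.valL d u‖]

/-- `(I - Δ)⁻¹` restricted to `L²`, with values in `H¹`. -/
def bessel (d : ℕ) : L2 d →L[ℝ] H1 d := (H1.valL d).adjoint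

lemma inner_bessel (v : L2 d) (φ : H1 d) : ⟪bessel d v, φ⟫ = ⟪v, H1.valL d φ⟫ :=
  ContinuousLinearMap.adjoint_inner_left _ _ _

lemma oneSubLaplacian_symm_toHNeg1 (v : L2 d) :
    (oneSubLaplacian d).symm (L2.toHNeg1 v) = bessel d v := by
  rw [LinearIsometryEquiv.symm_apply_eq]
  ext φ
  exact (inner_bessel v φ).symm

lemma toHNeg1_sub (u v : H1 d) : u.toHNeg1 - v.toHNeg1 = L2.toHNeg1 (u.val - v.val) := by
  ext φ
  exact (inner_sub_left u.val v.val (H1.valL d φ)).symm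

lemma HypBeta.valL_betaComp (hβ : HypBeta β) {K : ℝ≥0} (hK : LipschitzWith K β) (y : H1 d) :
    H1.valL d (betaComp hβ y) = hK.compLp hβ.map_zero y.val := by
  apply Lp.ext
  exact (betaComp_val hβ y).trans (hK.coeFn_compLp hβ.map_zero y.val).symm

/-- The term `∫ ∇β(y) · ∇φ` is the `H¹` product minus the `L²` product. With `φ = bessel d v` the
`H¹` product collapses to `⟪β(y), v⟫` in `L²`, so no gradient of `y` remains. -/
lemma AStar_apply_eq_inner (h : Hypotheses β b D Φ) {K : ℝ≥0} (hK : LipschitzWith K β)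
    (y φ : H1 d) :
    AStar h y φ = ⟪betaComp h.hypBeta y, φ⟫ - ⟪hK.compLp h.hypBeta.map_zero y.val, H1.valL d φ⟫
      - ⟪drift h.hypB h.hypD y.val, H1.gradL d φ⟫ := by
  rw [H1.inner_eq_add, h.hypBeta.valL_betaComp hK, add_sub_cancel_left, ← inner_sub_left]
  rfl

/-! ### Gårding inequality and solution of the resolvent equation. -/

/-- The pairing of `A* u - A* v` with `(I - Δ)⁻¹ (u - v)` controls the `L²` norm of `u - v` up to
a multiple of the `H⁻¹` norm. -/
lemma exists_garding (h : Hypotheses β b D Φ) {K : ℝ≥0} (hK : LipschitzWith K β) :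
    ∃ m c : ℝ, 0 < m ∧ 0 ≤ c ∧ ∀ u v : L2 d,
      m * ‖u - v‖ ^ 2 ≤
        ⟪hK.compLp h.hypBeta.map_zero u - hK.compLp h.hypBeta.map_zero v, u - v⟫
        - ⟪hK.compLp h.hypBeta.map_zero u - hK.compLp h.hypBeta.map_zero v,
            H1.valL d (bessel d (u - v))⟫
        - ⟪drift h.hypB h.hypD u - drift h.hypB h.hypD v, H1.gradL d (bessel d (u - v))⟫
        + c * ‖bessel d (u - v)‖ ^ 2 := by
  obtain ⟨γ, hγ, hinc⟩ := h.hypBeta.strongly_increasing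
  obtain ⟨C, hdrift⟩ := exists_lipschitz_drift h.hypB h.hypD
  -- Half of the monotonicity constant `γ` is spent on Young's inequality `h4` for `(K + C)‖u -
  -- v‖‖w‖`, which determines `c`.
  refine ⟨γ / 2, (K + C) ^ 2 / (2 * γ), by positivity, by positivity, fun u v => ?_⟩
  set w := bessel d (u - v)
  have h1 := le_inner_compLp_sub hK h.hypBeta.map_zero hinc u v
  have h2 := (real_inner_le_norm (hK.compLp h.hypBeta.map_zero u - hK.compLp h.hypBeta.map_zero v)
    (H1.valL d w)).trans (mul_le_mul (hK.norm_compLp_sub_le h.hypBeta.map_zero u v)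
      (H1.norm_valL_le w) (norm_nonneg _) (by positivity))
  have h3 := (real_inner_le_norm (drift h.hypB h.hypD u - drift h.hypB h.hypD v)
    (H1.gradL d w)).trans (mul_le_mul (hdrift.norm_sub_le u v)
      (H1.norm_gradL_le w) (norm_nonneg _) (by positivity))
  have h4 : (K + C) * ‖u - v‖ * ‖w‖ ≤
      γ / 2 * ‖u - v‖ ^ 2 + (K + C) ^ 2 / (2 * γ) * ‖w‖ ^ 2 := by
    have e : γ / 2 * ‖u - v‖ ^ 2 + (K + C) ^ 2 / (2 * γ) * ‖w‖ ^ 2 - (K + C) * ‖u - v‖ * ‖w‖ =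
        (γ * ‖u - v‖ - (K + C) * ‖w‖) ^ 2 / (2 * γ) := by
      field_simp
      ring
    have : 0 ≤ (γ * ‖u - v‖ - (K + C) * ‖w‖) ^ 2 / (2 * γ) := by positivity
    linarith
  linarith

/-- The weak resolvent equation `-Δ B(y) + div S(y) + μ y = f`, solved in `L²` for Lipschitz operators `B`, `S`
satisfying a Gårding inequality: the solution `y` is such that `B y ∈ H¹`. -/
lemma exists_resolvent_L2 {B : L2 d → L2 d} {S : L2 d → L2Vec d} {K K' : ℝ≥0}
    (hB : LipschitzWith K B) (hS : LipschitzWith K' S) {m c : ℝ} (hm : 0 < m)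
    (hgard : ∀ u v : L2 d, m * ‖u - v‖ ^ 2 ≤
      ⟪B u - B v, u - v⟫ - ⟪B u - B v, H1.valL d (bessel d (u - v))⟫
        - ⟪S u - S v, H1.gradL d (bessel d (u - v))⟫ + c * ‖bessel d (u - v)‖ ^ 2)
    {μ : ℝ} (hμ : c ≤ μ) (f : HNeg1 d) :
    ∃ (y : L2 d) (z : H1 d), H1.valL d z = B y ∧
      ∀ φ : H1 d, ⟪z, φ⟫ - ⟪B y, H1.valL d φ⟫ - ⟪S y, H1.gradL d φ⟫
        + μ * ⟪y, H1.valL d φ⟫ = f φ := by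
  -- Formally `Z y = (I - Δ)⁻¹(μ y - B y + div S y)`: the adjoint of the gradient represents `(I -
  -- Δ)⁻¹ ∘ (-div)`. The equation becomes `B y + Z y = (I - Δ)⁻¹ f`.
  set Z : L2 d → H1 d := fun y => μ • bessel d y - bessel d (B y) - (H1.gradL d).adjoint (S y)
  have hZ : ∀ y φ, ⟪Z y, φ⟫ =
      μ * ⟪y, H1.valL d φ⟫ - ⟪B y, H1.valL d φ⟫ - ⟪S y, H1.gradL d φ⟫ := by
    intro y φ
    simp only [Z, inner_sub_left, real_inner_smul_left, inner_bessel,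
      ContinuousLinearMap.adjoint_inner_left]
  have hF : ∃ L, LipschitzWith L fun y => B y + H1.valL d (Z y) :=
    ⟨_, hB.add ((H1.valL d).lipschitz.comp (((μ • bessel d).lipschitz.sub
      ((bessel d).lipschitz.comp hB)).sub ((H1.gradL d).adjoint.lipschitz.comp hS)))⟩
  obtain ⟨L, hL⟩ := hF
  have hmono : ∀ u v, m * ‖u - v‖ ^ 2 ≤
      ⟪B u + H1.valL d (Z u) - (B v + H1.valL d (Z v)), u - v⟫ := by
    intro u v
    refine (hgard u v).trans ?_
    -- As `bessel` is the adjoint of the inclusion, the `L²` product of `Z u - Z v` with `u - v` is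
    -- an `H¹` product with `bessel d (u - v)`, which `hZ` evaluates.
    have e1 : ⟪B u + H1.valL d (Z u) - (B v + H1.valL d (Z v)), u - v⟫ =
        ⟪B u - B v, u - v⟫ + ⟪Z u, bessel d (u - v)⟫ - ⟪Z v, bessel d (u - v)⟫ := by
      rw [real_inner_comm _ (Z u), real_inner_comm _ (Z v), inner_bessel, inner_bessel,
        real_inner_comm _ (u - v), real_inner_comm _ (u - v)]
      simp only [inner_sub_left, inner_add_left]
      ring
    have e2 : ‖bessel d (u - v)‖ ^ 2 = ⟪u - v, H1.valL d (bessel d (u - v))⟫ := by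
      rw [← real_inner_self_eq_norm_sq, inner_bessel]
    have e3 := mul_le_mul_of_nonneg_right hμ (sq_nonneg ‖bessel d (u - v)‖)
    rw [e1, hZ, hZ]
    rw [e2] at e3 ⊢
    rw [inner_sub_left u] at e3 ⊢
    rw [inner_sub_left (B u) _ (H1.valL d _), inner_sub_left (S u)]
    linarith
  obtain ⟨y, hy⟩ := surjective_of_stronglyMonotone_of_lipschitz (L := L) hm hmono
    (fun u v => hL.norm_sub_le u v) (H1.valL d ((oneSubLaplacian d).symm f))
  -- Both terms of this witness lie in `H¹`, and the solved equation identifies their difference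
  -- with `B y`: this is the gain of regularity.
  refine ⟨y, (oneSubLaplacian d).symm f - Z y, ?_, fun φ => ?_⟩
  · rw [map_sub, ← hy, add_sub_cancel_right]
  · have hf : ⟪(oneSubLaplacian d).symm f, φ⟫ = f φ := by
      conv_rhs => rw [← (oneSubLaplacian d).apply_symm_apply f]
      rfl
    rw [inner_sub_left, hZ, hf]
    ring

/-! ### Return to `H¹` and quasi-`m`-accretivity. -/

/-- If `β(y) ∈ H¹` then `y ∈ H¹`. -/
lemma HypBeta.exists_of_comp (hβ : HypBeta β) {K : ℝ≥0} (hK : LipschitzWith K β) {y : L2 d}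
    {z : H1 d} (hz : H1.valL d z = hK.compLp hβ.map_zero y) :
    ∃ w : H1 d, w.val = y ∧ betaComp hβ w = z := by
  obtain ⟨K', α, hα, hα0, hαβ⟩ := hβ.exists_lipschitz_inverse
  obtain ⟨G, hG⟩ := exists_isWeakGradient_compLp z.isWeakGradient hα hα0
  have hy : hα.compLp hα0 z.val = y := by
    apply Lp.ext
    have hz' : z.val =ᵐ[volume] fun x => β (y x) := by
      rw [show z.val = _ from hz]
      exact hK.coeFn_compLp hβ.map_zero y
    filter_upwards [hα.coeFn_compLp hα0 z.val, hz'] with x h1 h2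
    rw [h1, Function.comp_apply, h2, hαβ]
  rw [hy] at hG
  refine ⟨⟨WithLp.toLp 2 (y, G), hG⟩, rfl, H1.val_injective ?_⟩
  exact (hβ.valL_betaComp hK _).trans hz.symm

theorem isQuasiMAccretive_AStarOp (h : Hypotheses β b D Φ) :
    IsQuasiMAccretive (AStarDomain d) (AStarOp h) := by
  obtain ⟨K, hK⟩ := h.hypBeta.exists_lipschitz
  obtain ⟨C, hdrift⟩ := exists_lipschitz_drift h.hypB h.hypD
  obtain ⟨m, c, hm, hc, hgard⟩ := exists_garding h hK
  refine ⟨c, hc, ?_, fun r hr f => ?_⟩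
  · rintro ⟨_, y₁, rfl⟩ ⟨_, y₂, rfl⟩
    simp only [AStarOp_apply]
    -- The inner product of `H⁻¹` inverts `I - Δ` on its first argument, so symmetry is used to put
    -- `u₁ - u₂` there.
    rw [toHNeg1_sub, real_inner_comm, HNeg1.inner_def,
      oneSubLaplacian_symm_toHNeg1]
    set v := y₁.val - y₂.val with hv
    have e : (AStar h y₁ + c • y₁.toHNeg1 - (AStar h y₂ + c • y₂.toHNeg1))
        (bessel d v) = AStar h y₁ (bessel d v) - AStar h y₂ (bessel d v)
          + c * (y₁.toHNeg1 - y₂.toHNeg1) (bessel d v) := by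
      simp only [add_apply, sub_apply, smul_apply, smul_eq_mul]
      ring
    have e1 : (y₁.toHNeg1 - y₂.toHNeg1) (bessel d v) = ‖bessel d v‖ ^ 2 := by
      rw [toHNeg1_sub, ← real_inner_self_eq_norm_sq, inner_bessel]
      rfl
    have e2 : ∀ w : H1 d, ⟪w, bessel d v⟫ = ⟪H1.valL d w, v⟫ := fun w => by
      rw [real_inner_comm, inner_bessel, real_inner_comm]
    rw [e, e1, AStar_apply_eq_inner h hK, AStar_apply_eq_inner h hK, e2, e2,
      h.hypBeta.valL_betaComp hK, h.hypBeta.valL_betaComp hK]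
    have key := hgard y₁.val y₂.val
    rw [← hv, inner_sub_left, inner_sub_left, inner_sub_left] at key
    have : 0 ≤ m * ‖v‖ ^ 2 := by positivity
    linarith
  · obtain ⟨y, z, hz, hyz⟩ := exists_resolvent_L2 (hK.lipschitzWith_compLp h.hypBeta.map_zero)
      hdrift hm hgard (μ := c + r⁻¹)
      (le_add_of_nonneg_right (by positivity)) (r⁻¹ • f)
    obtain ⟨w, rfl, rfl⟩ := h.hypBeta.exists_of_comp hK hz
    refine ⟨⟨w.toHNeg1, w, rfl⟩, ?_⟩
    change w.toHNeg1 + r • (AStarOp h ⟨w.toHNeg1, w, rfl⟩ + c • w.toHNeg1) = f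
    rw [AStarOp_apply]
    ext φ
    have e1 := hyz φ
    have e2 : w.toHNeg1 φ = ⟪w.val, H1.valL d φ⟫ := rfl
    rw [← AStar_apply_eq_inner h hK] at e1
    simp only [add_apply, smul_apply, smul_eq_mul, e2] at e1 ⊢
    have e3 := congrArg (fun t => r * t) e1
    have hr' : r * r⁻¹ = 1 := mul_inv_cancel₀ hr.ne'
    simp only [mul_add, add_mul, ← mul_assoc, hr'] at e3 ⊢
    linarith

end Resolvent

end

end NFPE

theorem lemma2 {d : ℕ} (hd : 1 ≤ d) (β b : ℝ → ℝ) (D : NFPE.Space d → NFPE.Space d)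
    (Φ : NFPE.Space d → ℝ) (h : NFPE.Hypotheses β b D Φ) :
    NFPE.IsQuasiMAccretive (NFPE.AStarDomain d) (NFPE.AStarOp h) :=
  NFPE.isQuasiMAccretive_AStarOp h
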